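/- Assume the Continuum Hypothesis. Then for every selective ultrafilter $\mathcal U$ on $\mathbb N$ there is an ultrafilter $\mathcal V$ on $\mathbb N$ such that 1. $\mathcal V$ is above $\mathcal U$ in the Rudin–Keisler preordering, i.e. $\mathcal U=f(\mathcal V)=\{A\subseteq\mathbb N : f^{-1}(A)\in\mathcal V\}$ for some $f:\mathbb N\to\mathbb N$; 2. $\mathcal V$ is quasi-selective; 3. $\mathcal V$ is not selective, and in fact not even a Q-point; 4. $\mathcal V$ satisfies the partition relation $\mathbb N\to[\mathcal V]^2_3$: whenever the set $[\mathbb N]^2$ of two-element subsets of $\mathbb N$ is partitioned into $3$ pieces, there is $H\in\mathcal V$ such that $[H]^2$ meets at most $2$ of the pieces. Here $\mathbb N=\{0,1,2,\dots\}$. An ultrafilter on $\mathbb N$ is *selective* if it is nonprincipal and every function $f:\mathbb N\to\mathbb N$ is constant or one-to-one on some set of the ultrafilter; it is *quasi-selective* if it is nonprincipal and every $f:\mathbb N\to\mathbb N$ with $f(n)\le n$ for all $n$ agrees, on some set of the ultrafilter, with a nondecreasing function $\mathbb N\to\mathbb N$; it is a *Q-point* if every finite-to-one function $f:\mathbb N\to\mathbb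 N$ is one-to-one on some set of the ultrafilter. -/

import Mathlib

open Filter

/-- The Continuum Hypothesis, `2 ^ ℵ₀ = ℵ₁`. -/
def CH : Prop := Cardinal.continuum.{0} = Cardinal.aleph.{0} 1

namespace NatUltrafilter

/-- `U` is nonprincipal: it is not the ultrafilter of all sets containing a given point. -/
def Nonprincipal (U : Ultrafilter ℕ) : Prop := ∀ n : ℕ, U ≠ pure n

/-- `U` is selective (or Ramsey): it is nonprincipal, and every function on `ℕ` is constant or
one-to-one on some set in `U`. -/
def Selective (U : Ultrafilter ℕ) : Prop :=
  Nonprincipal U ∧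
    ∀ f : ℕ → ℕ, (∃ A ∈ U, ∃ c, ∀ n ∈ A, f n = c) ∨ (∃ A ∈ U, Set.InjOn f A)

/-- `U` is quasi-selective: it is nonprincipal, and every `f` with `f n ≤ n` for all `n` is equal,
on a set in `U`, to a nondecreasing function. -/
def QuasiSelective (U : Ultrafilter ℕ) : Prop :=
  Nonprincipal U ∧
    ∀ f : ℕ → ℕ, (∀ n, f n ≤ n) → ∃ g : ℕ → ℕ, Monotone g ∧ f =ᶠ[(U : Filter ℕ)] g

/-- `U` is a Q-point: every finite-to-one function on `ℕ` is one-to-one on some set in `U`.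
(Nonprincipality is not part of this definition, which makes its negation stronger.) -/
def QPoint (U : Ultrafilter ℕ) : Prop :=
  ∀ f : ℕ → ℕ, (∀ k, (f ⁻¹' {k}).Finite) → ∃ A ∈ U, Set.InjOn f A

/-- `V` is above `U` in the Rudin–Keisler preordering: `U = f(V)` for some function `f`. -/
def RudinKeislerAbove (V U : Ultrafilter ℕ) : Prop := ∃ f : ℕ → ℕ, V.map f = U

/-- The partition relation `ℕ → [V]²₃`: for every partition of the set of two-element subsets
of `ℕ` into three pieces there is `H ∈ V` such that the two-element subsets of `H` meet at most
two of the pieces. -/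
def SquareBracketPairsThree (V : Ultrafilter ℕ) : Prop :=
  ∀ F : Set.powersetCard ℕ 2 → Fin 3,
    ∃ H ∈ V, {i : Fin 3 | ∃ s : Set.powersetCard ℕ 2,
      ((s : Finset ℕ) : Set ℕ) ⊆ H ∧ F s = i}.ncard ≤ 2

end NatUltrafilter

namespace NatUltrafilter

/-! Fix a monotone finite-to-one `f` whose fibers become `Large k` along `U` for every `k`. The
conditions are the sets that still meet the fibers in this way, ordered by inclusion on `U`-almost
all fibers. This order is countably closed, and below every condition each 3-colouring of pairs can
be reduced to one colour inside fibers and one across fibers, over a set in `U`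
(`LargeAlong.exists_fiberHomogeneous`). Under CH there are only ℵ₁ colourings, so a chain of
conditions handles them all; `V` is any ultrafilter extending the filter it generates.

Then `f` maps `V` to `U`, and the two surviving colours give the partition relation. For a
regressive `g`, colour pairs by comparing values: "decreasing" cannot survive inside fibers, which
have more points than one of their members, nor across fibers, by infinite descent. Colouring pairs
by whether they meet `X` shows that `f` is not injective on any `X` in `V`. -/

theorem Nonprincipal.le_atTop {U : Ultrafilter ℕ} (hU : Nonprincipal U) :
    (U : Filter ℕ) ≤ atTop := by
  rw [← Nat.cofinite_eq_atTop]
  rcases U.le_cofinite_or_eq_pure with h | ⟨a, h⟩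
  · exact h
  · exact absurd h (hU a)

theorem Nonprincipal.eventually_ge {U : Ultrafilter ℕ} (hU : Nonprincipal U) (m : ℕ) :
    ∀ᶠ n in (U : Filter ℕ), m ≤ n :=
  hU.le_atTop (eventually_ge_atTop m)

/-- The function sending `x` to the index of the interval `[a n, a (n + 1))` containing it. -/
theorem exists_interval_index {a : ℕ → ℕ} (ha : StrictMono a) (h0 : a 0 = 0) :
    ∃ q : ℕ → ℕ, Monotone q ∧ ∀ x n, q x = n ↔ a n ≤ x ∧ x < a (n + 1) := by
  have hex : ∀ x, ∃ n, a n ≤ x ∧ x < a (n + 1) := by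
    intro x
    have h : ∃ n, x < a (n + 1) := ⟨x, (Nat.lt_succ_self x).trans_le (ha.id_le _)⟩
    refine ⟨Nat.find h, ?_, Nat.find_spec h⟩
    rcases hn : Nat.find h with _ | m
    · simp [h0]
    · exact not_lt.mp (Nat.find_min h (m := m) (by omega))
  choose q hq using hex
  refine ⟨q, fun x y hxy => ?_, fun x n => ⟨fun h => h ▸ hq x, fun h => ?_⟩⟩
  · have := ha.lt_iff_lt.mp (((hq x).1.trans hxy).trans_lt (hq y).2)
    omega
  have h1 := ha.lt_iff_lt.mp ((hq x).1.trans_lt h.2)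
  have h2 := ha.lt_iff_lt.mp (h.1.trans_lt (hq x).2)
  omega

/-- Cut `ℕ` into intervals that outgrow `h`. Selectivity picks at most one point per interval, and
fixing the parity of the index leaves a whole interval between any two points. -/
theorem Selective.exists_sparse {U : Ultrafilter ℕ} (hU : Selective U) (h : ℕ → ℕ) :
    ∃ S ∈ U, ∀ m ∈ S, ∀ n ∈ S, m < n → h m ≤ n := by
  let b : ℕ → ℕ := fun k => Nat.rec 0 (fun _ r => r + 1 + ∑ i ∈ Finset.range (r + 1), h i) k
  have hb : ∀ k, b (k + 1) = b k + 1 + ∑ i ∈ Finset.range (b k + 1), h i := fun k => rfl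
  have hmono : StrictMono b := strictMono_nat_of_lt_succ fun k => by rw [hb]; omega
  have hbh : ∀ k m, m ≤ b k → h m ≤ b (k + 1) := by
    intro k m hm
    have := Finset.single_le_sum (f := h) (fun i _ => Nat.zero_le _)
      (Finset.mem_range.mpr (Nat.lt_succ_of_le hm))
    rw [hb]
    exact this.trans (Nat.le_add_left _ _)
  obtain ⟨q, hqm, hq⟩ := exists_interval_index hmono rfl
  rcases hU.2 q with ⟨A, hA, c, hc⟩ | ⟨A, hA, hinj⟩
  · obtain ⟨n, hn, hn'⟩ := (hU.1.eventually_ge (b (c + 1))).and hA |>.exists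
    have := ((hq n c).mp (hc n hn')).2
    omega
  · have key : ∀ m ∈ A, ∀ n ∈ A, m < n → q m % 2 = q n % 2 → h m ≤ n := by
      intro m hm n hn hmn hpar
      have h1 := hqm hmn.le
      have h2 : q m ≠ q n := fun e => hmn.ne (hinj hm hn e)
      have h3 : q m + 2 ≤ q n := by omega
      exact (hbh (q m + 1) m ((hq m _).mp rfl).2.le).trans
        ((hmono.monotone h3).trans ((hq n _).mp rfl).1)
    rcases U.em (fun n => q n % 2 = 0) with he | he
    · exact ⟨_, inter_mem hA he, fun m hm n hn hmn =>
        key m hm.1 n hn.1 hmn (hm.2.trans hn.2.symm)⟩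
    · refine ⟨_, inter_mem hA he, fun m hm n hn hmn => key m hm.1 n hn.1 hmn ?_⟩
      have h1 : ¬ q m % 2 = 0 := hm.2
      have h2 : ¬ q n % 2 = 0 := hn.2
      omega

/-- Selective ultrafilters are closed under diagonal intersections. -/
theorem Selective.exists_diagonal {U : Ultrafilter ℕ} (hU : Selective U) {D : ℕ → Set ℕ}
    (hD : ∀ m, D m ∈ U) : ∃ S ∈ U, ∀ m ∈ S, ∀ n ∈ S, m < n → n ∈ D m := by
  have hex : ∀ n, ∃ k, n ≤ k ∨ n ∉ D k := fun n => ⟨n, Or.inl le_rfl⟩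
  classical
  -- First `k` with `n ∉ D k`, capped at `n` so that it always exists.
  let g : ℕ → ℕ := fun n => Nat.find (hex n)
  have hg : ∀ n m, m < g n → n ∈ D m := fun n m hm => by
    have := Nat.find_min (hex n) hm
    push Not at this
    exact this.2
  rcases hU.2 g with ⟨A, hA, c, hc⟩ | ⟨A, hA, hinj⟩
  · obtain ⟨n, ⟨hn, hn'⟩, hn''⟩ := ((hU.1.eventually_ge (c + 1)).and hA).and (hD c) |>.exists
    have := Nat.find_spec (hex n)
    have e : Nat.find (hex n) = c := hc n hn'
    rw [e] at this
    rcases this with h | h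
    · omega
    · exact absurd hn'' h
  · have hfin : ∀ m, ∃ N, ∀ n ∈ A, g n ≤ m → n < N := by
      intro m
      have : {n ∈ A | g n ≤ m}.Finite :=
        Set.Finite.of_finite_image ((Set.finite_Iic m).subset (by rintro _ ⟨n, hn, rfl⟩; exact hn.2))
          (hinj.mono fun n hn => hn.1)
      obtain ⟨N, hN⟩ := this.bddAbove
      exact ⟨N + 1, fun n hn h => Nat.lt_succ_of_le (hN ⟨hn, h⟩)⟩
    choose N hN using hfin
    obtain ⟨S, hS, hSN⟩ := hU.exists_sparse N
    refine ⟨_, inter_mem hA hS, fun m hm n hn hmn => hg n m ?_⟩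
    by_contra hlt
    exact absurd (hN m n hn.1 (not_lt.mp hlt)) (not_lt.mpr (hSN m hm.2 n hn.2 hmn))

/-- `s` is homogeneous of colour `c` for the colouring `F` of increasing pairs. -/
def Homogeneous (F : ℕ → ℕ → Fin 3) (c : Fin 3) (s : Set ℕ) : Prop :=
  ∀ x ∈ s, ∀ y ∈ s, x < y → F x y = c

/-- Selective ultrafilters are Ramsey. -/
theorem Selective.exists_homogeneous {U : Ultrafilter ℕ} (hU : Selective U)
    (F : ℕ → ℕ → Fin 3) : ∃ S ∈ U, ∃ c, Homogeneous F c S := by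
  have h1 : ∀ x, ∃ c, ∀ᶠ y in (U : Filter ℕ), F x y = c := fun x =>
    Ultrafilter.eventually_exists_iff.mp (Eventually.of_forall fun y => ⟨_, rfl⟩)
  choose c hc using h1
  obtain ⟨d, hd⟩ : ∃ d, ∀ᶠ x in (U : Filter ℕ), c x = d :=
    Ultrafilter.eventually_exists_iff.mp (Eventually.of_forall fun y => ⟨_, rfl⟩)
  obtain ⟨S, hS, h⟩ := hU.exists_diagonal (D := fun x => {y | F x y = c x}) hc
  exact ⟨_, inter_mem hS hd, d, fun x hx y hy hxy => (h x hx.1 y hy.1 hxy).trans hx.2⟩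

/-! ### Largeness of finite sets -/

/-- A hierarchy of largeness notions: `Large 0 s` says that `s` has more elements than one of its
members, and `Large (k + 1) s` that every 3-colouring of the pairs of elements of `s` has a
homogeneous set that is `Large k`. -/
def Large : ℕ → Set ℕ → Prop
  | 0, s => ∃ t : Finset ℕ, (t : Set ℕ) ⊆ s ∧ ∃ x ∈ t, x + 2 < t.card
  | k + 1, s => ∀ F : ℕ → ℕ → Fin 3, ∃ B ⊆ s, Large k B ∧ ∃ c, Homogeneous F c B

theorem Large.mono {k : ℕ} {s t : Set ℕ} (hs : Large k s) (hst : s ⊆ t) : Large k t := by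
  cases k with
  | zero =>
    obtain ⟨u, hu, h⟩ := hs
    exact ⟨u, hu.trans hst, h⟩
  | succ k =>
    intro F
    obtain ⟨B, hB, h⟩ := hs F
    exact ⟨B, hB.trans hst, h⟩

theorem Large.of_le {k l : ℕ} {s : Set ℕ} (hs : Large l s) (hkl : k ≤ l) : Large k s := by
  induction hkl with
  | refl => exact hs
  | step _ ih =>
    obtain ⟨B, hB, h, -⟩ := hs fun _ _ => 0
    exact ih (h.mono hB)

/-- A large set is not covered by few sets none of which is slightly less large. -/
theorem Large.exists_fiber {α : Type*} {k N : ℕ} {s : Set ℕ} (hs : Large (k + 1) s)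
    (hN : ∀ x ∈ s, N ≤ x + 2) (φ : ℕ → α) {T : Finset α} (hT : ∀ x ∈ s, φ x ∈ T)
    (hTN : T.card ≤ N) : ∃ B ⊆ s, Large k B ∧ ∃ a, ∀ x ∈ B, φ x = a := by
  classical
  obtain ⟨B, hB, hBk, c, hc⟩ := hs fun x y => if φ x = φ y then 0 else 1
  refine ⟨B, hB, hBk, ?_⟩
  obtain ⟨t, htB, x, hx, hcard⟩ := hBk.of_le (Nat.zero_le k)
  by_cases hc0 : c = 0
  · subst hc0
    refine ⟨φ x, fun y hy => ?_⟩
    rcases lt_trichotomy x y with h | h | h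
    · have := hc x (htB hx) y hy h
      by_contra hne
      dsimp only at this
      rw [if_neg (Ne.symm hne)] at this
      simp at this
    · rw [h]
    · have := hc y hy x (htB hx) h
      by_contra hne
      dsimp only at this
      rw [if_neg hne] at this
      simp at this
  · exfalso
    have hlt : ∀ x ∈ B, ∀ y ∈ B, x < y → φ x ≠ φ y := by
      intro x hx y hy hxy he
      have := hc x hx y hy hxy
      dsimp only at this
      rw [if_pos he] at this
      exact hc0 this.symm
    have hinj : Set.InjOn φ (t : Set ℕ) := by
      intro x hx y hy he
      rcases lt_trichotomy x y with h | h | h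
      · exact absurd he (hlt x (htB hx) y (htB hy) h)
      · exact h
      · exact absurd he.symm (hlt y (htB hy) x (htB hx) h)
    -- Injectivity would give `t.card ≤ N ≤ x + 2`, against the margin built into `Large 0`.
    have := Finset.card_le_card_of_injOn φ (fun y hy => hT y (hB (htB hy))) hinj
    have := hN x (hB (htB hx))
    omega

/-- A Paris–Harrington style lemma: every set in a selective ultrafilter has bounded large
subsets. -/
theorem Selective.exists_large {U : Ultrafilter ℕ} (hU : Selective U) (k : ℕ) :
    ∀ X ∈ U, ∃ N, Large k (X ∩ Set.Iio N) := by
  induction k with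
  | zero =>
    intro X hX
    have hinf : X.Infinite := fun hfin => by
      obtain ⟨x, -, hx⟩ := Ultrafilter.eq_pure_of_finite_mem hfin hX
      exact hU.1 x hx
    obtain ⟨x, hx⟩ := hinf.nonempty
    obtain ⟨t, htX, ht⟩ := hinf.exists_subset_card_eq (x + 3)
    refine ⟨(insert x t).sup id + 1, insert x t, ?_, x, Finset.mem_insert_self _ _, ?_⟩
    · intro y hy
      refine ⟨?_, Nat.lt_succ_of_le (Finset.le_sup (f := id) hy)⟩
      rcases Finset.mem_insert.mp hy with rfl | hy
      · exact hx
      · exact htX hy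
    · have := Finset.card_le_card (Finset.subset_insert x t)
      omega
  | succ k ih =>
    intro X hX
    by_contra! hno
    have hbad : ∀ N, ∃ F : ℕ → ℕ → Fin 3, ∀ B ⊆ X ∩ Set.Iio N, Large k B →
        ∀ c, ¬ Homogeneous F c B := by
      intro N
      have := hno N
      simp only [Large] at this
      push Not at this
      exact this
    choose F hF using hbad
    -- Compactness: a bounded large set homogeneous for the `U`-limit `G` of the bad colourings is
    -- homogeneous for some `F N`.
    have hlim : ∀ x y, ∃ c, ∀ᶠ N in (U : Filter ℕ), F N x y = c := fun x y =>
      Ultrafilter.eventually_exists_iff.mp (Eventually.of_forall fun y => ⟨_, rfl⟩)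
    choose G hG using hlim
    obtain ⟨S, hS, c, hc⟩ := hU.exists_homogeneous G
    obtain ⟨M, hM⟩ := ih _ (inter_mem hX hS)
    have hev : ∀ᶠ N in (U : Filter ℕ), ∀ x ∈ Set.Iio M, ∀ y ∈ Set.Iio M, F N x y = G x y :=
      (eventually_all_finite (Set.finite_Iio M)).mpr fun x _ =>
        (eventually_all_finite (Set.finite_Iio M)).mpr fun y _ => hG x y
    obtain ⟨N, hN, hMN⟩ := (hev.and (hU.1.eventually_ge M)).exists
    exact hF N _ (fun x hx => ⟨hx.1.1, lt_of_lt_of_le hx.2 hMN⟩) hM c fun x hx y hy hxy =>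
      (hN x hx.2 y hy.2).trans (hc x hx.1.2 y hy.1.2 hxy)

/-! ### The projection and the order of conditions -/

/-- A finite-to-one projection with larger and larger fibers. -/
structure LargeFibers (U : Ultrafilter ℕ) (f : ℕ → ℕ) : Prop where
  monotone : Monotone f
  le_self : ∀ x, f x ≤ x
  finite_fiber : ∀ n, (f ⁻¹' {n}).Finite
  large : ∀ k, ∀ᶠ n in (U : Filter ℕ), Large k (f ⁻¹' {n})

theorem Selective.exists_largeFibers {U : Ultrafilter ℕ} (hU : Selective U) :
    ∃ f, LargeFibers U f := by
  have hnext : ∀ a k, ∃ N, Large k (Set.Ici a ∩ Set.Iio N) := fun a k =>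
    hU.exists_large k _ (hU.1.eventually_ge a)
  choose N hN using hnext
  let a : ℕ → ℕ := fun n => Nat.rec 0 (fun k r => r + 1 + N r k) n
  have ha : ∀ k, a (k + 1) = a k + 1 + N (a k) k := fun k => rfl
  have hmono : StrictMono a := strictMono_nat_of_lt_succ fun k => by rw [ha]; omega
  obtain ⟨q, hqm, hq⟩ := exists_interval_index hmono rfl
  have hfib : ∀ n, q ⁻¹' {n} = Set.Ici (a n) ∩ Set.Iio (a (n + 1)) := fun n => by
    ext x
    exact hq x n
  refine ⟨q, hqm, ?_, ?_, ?_⟩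
  · exact fun x => (hmono.id_le _).trans ((hq x _).mp rfl).1
  · exact fun n => by rw [hfib]; exact (Set.finite_Iio _).subset Set.inter_subset_right
  · intro k
    filter_upwards [hU.1.eventually_ge k] with n hn
    rw [hfib]
    refine ((hN (a n) n).mono ?_).of_le hn
    intro x hx
    have h1 : x < N (a n) n := hx.2
    have h2 := ha n
    refine ⟨hx.1, ?_⟩
    change x < a (n + 1)
    omega

/-- The conditions: sets whose intersections with the fibers of `f` become arbitrarily large
along `U`. -/
def LargeAlong (U : Ultrafilter ℕ) (f : ℕ → ℕ) (A : Set ℕ) : Prop :=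
  ∀ k, ∀ᶠ n in (U : Filter ℕ), Large k (A ∩ f ⁻¹' {n})

/-- `A` is contained in `B` on almost all fibers of `f`. -/
def AlmostSubset (U : Ultrafilter ℕ) (f : ℕ → ℕ) (A B : Set ℕ) : Prop :=
  ∀ᶠ n in (U : Filter ℕ), A ∩ f ⁻¹' {n} ⊆ B

theorem AlmostSubset.refl (U : Ultrafilter ℕ) (f : ℕ → ℕ) (A : Set ℕ) : AlmostSubset U f A A :=
  Eventually.of_forall fun _ => Set.inter_subset_left

theorem AlmostSubset.trans {U : Ultrafilter ℕ} {f : ℕ → ℕ} {A B C : Set ℕ}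
    (h₁ : AlmostSubset U f A B) (h₂ : AlmostSubset U f B C) : AlmostSubset U f A C := by
  filter_upwards [h₁, h₂] with n h1 h2 x hx
  exact h2 ⟨h1 hx, hx.2⟩

/-- Shrinking all fibers of a condition simultaneously. -/
theorem LargeAlong.exists_shrink {U : Ultrafilter ℕ} (hU : Nonprincipal U) {f : ℕ → ℕ} {A : Set ℕ}
    {Q : ℕ → Set ℕ → Prop}
    (h : ∀ k, ∀ᶠ n in (U : Filter ℕ), ∃ B ⊆ A ∩ f ⁻¹' {n}, Large k B ∧ Q n B) :
    ∃ B ⊆ A, LargeAlong U f B ∧ ∀ᶠ n in (U : Filter ℕ), Q n (B ∩ f ⁻¹' {n}) := by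
  classical
  -- Over `n`, use the best level `k ≤ n` available; it tends to infinity along `U`.
  let P : ℕ → ℕ → Prop := fun n k => ∃ B ⊆ A ∩ f ⁻¹' {n}, Large k B ∧ Q n B
  have hspec : ∀ n, ∃ B ⊆ A ∩ f ⁻¹' {n}, (∃ k, P n k) →
      Large (Nat.findGreatest (P n) n) B ∧ (P n 0 → Q n B) := by
    intro n
    by_cases h0 : P n 0
    · obtain ⟨B, hB, h1, h2⟩ := Nat.findGreatest_spec (P := P n) (Nat.zero_le n) h0
      exact ⟨B, hB, fun _ => ⟨h1, fun _ => h2⟩⟩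
    · refine ⟨∅, Set.empty_subset _, fun ⟨k, B, hB, h1, h2⟩ => absurd ?_ h0⟩
      exact ⟨B, hB, h1.of_le (Nat.zero_le k), h2⟩
  choose C hCA hC using hspec
  have hfib : ∀ n, {x | x ∈ C (f x)} ∩ f ⁻¹' {n} = C n := by
    intro n
    ext x
    constructor
    · rintro ⟨hx, rfl⟩
      exact hx
    · intro hx
      have : f x = n := (hCA n hx).2
      exact ⟨by simpa [this] using hx, this⟩
  refine ⟨{x | x ∈ C (f x)}, fun x hx => (hCA _ hx).1, fun k => ?_, ?_⟩
  · filter_upwards [h k, hU.eventually_ge k] with n hn hk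
    rw [hfib]
    exact (hC n ⟨k, hn⟩).1.of_le (Nat.le_findGreatest hk hn)
  · filter_upwards [h 0] with n hn
    rw [hfib]
    exact (hC n ⟨0, hn⟩).2 hn

/-- Countable decreasing sequences of conditions have lower bounds. -/
theorem LargeAlong.exists_lowerBound {U : Ultrafilter ℕ} (hU : Nonprincipal U) {f : ℕ → ℕ}
    {A : ℕ → Set ℕ} (hA : ∀ n, LargeAlong U f (A n))
    (hdec : ∀ n, AlmostSubset U f (A (n + 1)) (A n)) :
    ∃ B, LargeAlong U f B ∧ ∀ n, AlmostSubset U f B (A n) := by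
  classical
  have hle : ∀ m, ∀ᶠ n in (U : Filter ℕ), ∀ i ≤ m, A m ∩ f ⁻¹' {n} ⊆ A i := by
    intro m
    induction m with
    | zero =>
      refine Eventually.of_forall fun n i hi => ?_
      rw [Nat.le_zero.mp hi]
      exact Set.inter_subset_left
    | succ m ih =>
      filter_upwards [ih, hdec m] with n h1 h2 i hi x hx
      rcases Nat.le_succ_iff.mp hi with h | rfl
      · exact h1 i h ⟨h2 hx, hx.2⟩
      · exact hx.1
  let P : ℕ → ℕ → Prop := fun n k =>
    (∀ i ≤ k, A k ∩ f ⁻¹' {n} ⊆ A i) ∧ Large k (A k ∩ f ⁻¹' {n})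
  have hP : ∀ k, ∀ᶠ n in (U : Filter ℕ), P n k := fun k => (hle k).and (hA k k)
  let q : ℕ → ℕ := fun n => Nat.findGreatest (P n) n
  have hfib : ∀ n, {x | x ∈ A (q (f x))} ∩ f ⁻¹' {n} = A (q n) ∩ f ⁻¹' {n} := by
    intro n
    ext x
    constructor
    · rintro ⟨hx, rfl⟩
      exact ⟨hx, rfl⟩
    · rintro ⟨hx, rfl⟩
      exact ⟨hx, rfl⟩
  have key : ∀ k, ∀ᶠ n in (U : Filter ℕ), k ≤ q n ∧ P n (q n) := by
    intro k
    filter_upwards [hP k, hU.eventually_ge k] with n hn hk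
    exact ⟨Nat.le_findGreatest hk hn, Nat.findGreatest_spec (P := P n) hk hn⟩
  refine ⟨{x | x ∈ A (q (f x))}, fun k => ?_, fun k => ?_⟩
  · filter_upwards [key k] with n hn
    rw [hfib]
    exact hn.2.2.of_le hn.1
  · filter_upwards [key k] with n hn
    rw [hfib]
    exact hn.2.1 k hn.1

/-- On the fibers of `f` over `S`, the pairs in `A` have colour `i` inside a fiber and
colour `j` across fibers. -/
def FiberHomogeneous (f : ℕ → ℕ) (F : ℕ → ℕ → Fin 3) (i j : Fin 3) (S A : Set ℕ) : Prop :=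
  ∀ x ∈ A, ∀ y ∈ A, f x ∈ S → f y ∈ S → x < y →
    (f x = f y → F x y = i) ∧ (f x < f y → F x y = j)

theorem LargeAlong.exists_fiberHomogeneous {U : Ultrafilter ℕ} (hU : Selective U) {f : ℕ → ℕ}
    (hf : LargeFibers U f) {A : Set ℕ} (hA : LargeAlong U f A) (F : ℕ → ℕ → Fin 3) :
    ∃ B ⊆ A, LargeAlong U f B ∧ ∃ i j, ∃ S ∈ U, FiberHomogeneous f F i j S B := by
  classical
  have hfin : ∀ m, (f ⁻¹' Set.Iic m).Finite := fun m =>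
    (Set.finite_Iic m).preimage' fun n _ => hf.finite_fiber n
  -- This counts the colour patterns of a point towards all fibers up to `m`. For a later `n ∈ S` it
  -- is at most `n`, hence at most any point of the fiber over `n`, so unifying the patterns costs
  -- one level of largeness.
  obtain ⟨S, hS, hsparse⟩ := hU.exists_sparse
    fun m => Fintype.card ((hfin m).toFinset → Fin 3)
  -- on each fiber, make the colours of pairs reaching back independent of the larger element
  obtain ⟨B, hBA, hB, hBS⟩ := LargeAlong.exists_shrink hU.1 (f := f) (A := A)
    (Q := fun n B => ∀ x, f x ∈ S → f x < n → ∃ c, ∀ y ∈ B, F x y = c) (by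
      intro k
      filter_upwards [hA (k + 1), hS] with n hn hnS
      by_cases hne : ∃ m ∈ S, m < n
      · obtain ⟨m, ⟨hmS, hmn⟩, hmax⟩ : ∃ m, (m ∈ S ∧ m < n) ∧ ∀ l, l ∈ S ∧ l < n → l ≤ m := by
          obtain ⟨m₀, hm₀⟩ := hne
          refine ⟨Nat.findGreatest (fun m => m ∈ S ∧ m < n) n,
            Nat.findGreatest_spec (P := fun m => m ∈ S ∧ m < n) hm₀.2.le hm₀, fun l hl => ?_⟩
          exact Nat.le_findGreatest hl.2.le hl
        obtain ⟨C, hC, hCk, a, ha⟩ := hn.exists_fiber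
          (N := Fintype.card ((hfin m).toFinset → Fin 3))
          (fun x hx => by
            have h1 : f x = n := hx.2
            have h2 := hf.le_self x
            have h3 := hsparse m hmS n hnS hmn
            omega)
          (fun y (x : (hfin m).toFinset) => F x y) (T := Finset.univ)
          (fun _ _ => Finset.mem_univ _) (Finset.card_univ).le
        refine ⟨C, hC, hCk, fun x hxS hxn => ?_⟩
        have hxm : x ∈ (hfin m).toFinset :=
          (hfin m).mem_toFinset.mpr (hmax _ ⟨hxS, hxn⟩)
        exact ⟨a ⟨x, hxm⟩, fun y hy => congrFun (ha y hy) ⟨x, hxm⟩⟩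
      · push Not at hne
        exact ⟨_, subset_rfl, hn.of_le (Nat.le_succ k), fun x hxS hxn =>
          absurd hxn (not_lt.mpr (hne _ hxS))⟩)
  -- the limit colour of a point
  have hlim : ∀ x, f x ∈ S → ∃ c, ∀ᶠ n in (U : Filter ℕ), ∀ y ∈ B ∩ f ⁻¹' {n}, F x y = c := by
    intro x hx
    refine Ultrafilter.eventually_exists_iff.mp ?_
    filter_upwards [hBS, hU.1.eventually_ge (f x + 1)] with n hn hxn
    exact hn x hx hxn
  have hlim' : ∀ x, ∃ c, f x ∈ S →
      ∀ᶠ n in (U : Filter ℕ), ∀ y ∈ B ∩ f ⁻¹' {n}, F x y = c := by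
    intro x
    by_cases hx : f x ∈ S
    · obtain ⟨c, hc⟩ := hlim x hx
      exact ⟨c, fun _ => hc⟩
    · exact ⟨0, fun h => absurd h hx⟩
  choose c hc using hlim'
  obtain ⟨S', hS', hdiag⟩ := hU.exists_diagonal
    (D := fun m => {n | ∀ x ∈ f ⁻¹' {m}, f x ∈ S → ∀ y ∈ B ∩ f ⁻¹' {n}, F x y = c x})
    (fun m => (eventually_all_finite (hf.finite_fiber m)).mpr fun x _ => by
      by_cases hx : f x ∈ S
      · exact (hc x hx).mono fun n hn _ => hn
      · exact Eventually.of_forall fun n h => absurd h hx)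
  -- make each fiber homogeneous, with constant limit colour
  obtain ⟨C, hCB, hC, hCU⟩ := LargeAlong.exists_shrink hU.1 (f := f) (A := B)
    (Q := fun _ C => ∃ j i, (∀ x ∈ C, c x = j) ∧ Homogeneous F i C) (by
      intro k
      -- One level pays for a constant limit colour, the other for homogeneity.
      filter_upwards [hB (k + 2), hU.1.eventually_ge 3] with n hn hn3
      obtain ⟨C, hC, hCk, j, hj⟩ := hn.exists_fiber (N := 3)
        (fun x hx => by
          have h1 : f x = n := hx.2
          have h2 := hf.le_self x
          omega) c (T := Finset.univ) (fun _ _ => Finset.mem_univ _) (by simp)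
      obtain ⟨E, hE, hEk, i, hi⟩ := hCk F
      exact ⟨E, hE.trans hC, hEk, j, i, fun x hx => hj x (hE hx), hi⟩)
  obtain ⟨j, hj⟩ := Ultrafilter.eventually_exists_iff.mp hCU
  obtain ⟨i, hi⟩ := Ultrafilter.eventually_exists_iff.mp hj
  refine ⟨C, hCB.trans hBA, hC, i, j, _, inter_mem (inter_mem hS hS') hi, ?_⟩
  rintro x hx y hy ⟨⟨hxS, hxS'⟩, hxi⟩ ⟨⟨hyS, hyS'⟩, hyi⟩ hxy
  constructor
  · intro h
    exact hxi.2 x ⟨hx, rfl⟩ y ⟨hy, h.symm⟩ hxy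
  · intro h
    have h1 := hdiag _ hxS' _ hyS' h x rfl hxS y ⟨hCB hy, rfl⟩
    exact h1.trans (hxi.1 x ⟨hx, rfl⟩)

/-! ### The generic ultrafilter under CH -/

/-- A chain of length `ω₁` meeting `ℵ₁` many dense sets of a preorder in which countable decreasing
sequences have lower bounds. -/
theorem exists_chain_of_dense {P ι : Type} [Nonempty P] {le : P → P → Prop} (hrefl : ∀ p, le p p)
    (htrans : ∀ p q r, le p q → le q r → le p r)
    (hseq : ∀ p : ℕ → P, (∀ n, le (p (n + 1)) (p n)) → ∃ q, ∀ n, le q (p n))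
    (hι : Cardinal.mk ι ≤ Cardinal.aleph 1) {D : ι → Set P}
    (hD : ∀ i p, ∃ q ∈ D i, le q p) :
    ∃ g : ι → P, (∀ i, g i ∈ D i) ∧ ∀ i j, le (g i) (g j) ∨ le (g j) (g i) := by
  classical
  obtain ⟨r, hwo, hr⟩ := Cardinal.exists_ord_eq ι
  have hcount : ∀ i, {j | r j i}.Countable := by
    intro i
    have h2 : Cardinal.mk {j // r j i} < Cardinal.aleph 1 :=
      (Cardinal.card_typein_lt i hr).trans_le hι
    rw [← Cardinal.succ_aleph0, Order.lt_succ_iff] at h2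
    exact Cardinal.le_aleph0_iff_set_countable.mp h2
  have hwf : WellFounded r := hwo.wf
  let g : ι → P := hwf.fix fun i rec =>
    if h : ∃ q ∈ D i, ∀ j (hj : r j i), le q (rec j hj) then h.choose else Classical.arbitrary P
  have hg : ∀ i, (∃ q ∈ D i, ∀ j, r j i → le q (g j)) → g i ∈ D i ∧ ∀ j, r j i → le (g i) (g j) := by
    intro i h
    have e : g i = h.choose := by
      change hwf.fix _ i = _
      rw [hwf.fix_eq]
      exact dif_pos h
    rw [e]
    exact h.choose_spec
  have main : ∀ i, g i ∈ D i ∧ ∀ j, r j i → le (g i) (g j) := by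
    intro i
    induction i using hwf.induction with
    | _ i ih =>
      apply hg
      rcases Set.eq_empty_or_nonempty {j | r j i} with he | hne
      · obtain ⟨q, hq, -⟩ := hD i (Classical.arbitrary P)
        exact ⟨q, hq, fun j hj => absurd (show j ∈ {j | r j i} from hj) (by simp [he])⟩
      · obtain ⟨e, he⟩ := (hcount i).exists_eq_range hne
        have hei : ∀ n, r (e n) i := fun n => by
          have : e n ∈ {j | r j i} := he ▸ Set.mem_range_self n
          exact this
        -- Running `r`-maximum of `e`: it turns the countably many predecessors into a decreasing
        -- sequence of conditions below all of them.
        let m : ℕ → ι := fun n => Nat.rec (e 0) (fun n a => if r a (e (n + 1)) then e (n + 1) else a) n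
        have hm : ∀ n, m (n + 1) = if r (m n) (e (n + 1)) then e (n + 1) else m n := fun n => rfl
        have hmi : ∀ n, r (m n) i := by
          intro n
          induction n with
          | zero => exact hei 0
          | succ n ihn =>
            rw [hm]
            split_ifs
            · exact hei _
            · exact ihn
        have htot : ∀ a b, r a i → r b i → ¬ r a b → le (g a) (g b) := by
          intro a b ha hb hab
          rcases trichotomous_of r a b with h | rfl | h
          · exact absurd h hab
          · exact hrefl _
          · exact (ih a ha).2 b h
        have hstep : ∀ n, le (g (m (n + 1))) (g (m n)) := by
          intro n
          rw [hm]
          split_ifs with h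
          · exact (ih _ (hei _)).2 _ h
          · exact hrefl _
        have hme : ∀ n, le (g (m n)) (g (e n)) := by
          intro n
          cases n with
          | zero => exact hrefl _
          | succ n =>
            rw [hm]
            split_ifs with h
            · exact hrefl _
            · exact htot _ _ (hmi n) (hei _) h
        obtain ⟨p, hp⟩ := hseq (fun n => g (m n)) hstep
        obtain ⟨q, hq, hqp⟩ := hD i p
        refine ⟨q, hq, fun j hj => ?_⟩
        have : j ∈ Set.range e := he ▸ (show j ∈ {j | r j i} from hj)
        obtain ⟨n, rfl⟩ := this
        exact htrans _ _ _ hqp (htrans _ _ _ (hp n) (hme n))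
  refine ⟨g, fun i => (main i).1, fun i j => ?_⟩
  rcases trichotomous_of r i j with h | rfl | h
  · exact Or.inr ((main j).2 i h)
  · exact Or.inl (hrefl _)
  · exact Or.inl ((main i).2 j h)

theorem exists_generic_ultrafilter (hCH : CH) {U : Ultrafilter ℕ} (hU : Selective U) {f : ℕ → ℕ}
    (hf : LargeFibers U f) :
    ∃ V : Ultrafilter ℕ, V.map f = U ∧ ∀ F : ℕ → ℕ → Fin 3, ∃ A ∈ V, LargeAlong U f A ∧
      ∃ i j, ∃ S ∈ U, FiberHomogeneous f F i j S A := by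
  have hcard : Cardinal.mk (ℕ → ℕ → Fin 3) ≤ Cardinal.aleph 1 := by
    rw [← hCH, ← Cardinal.power_def, ← Cardinal.power_def, ← Cardinal.power_mul, Cardinal.mk_nat,
      Cardinal.aleph0_mul_aleph0]
    exact (Cardinal.power_le_power_right (by simp)).trans
      Cardinal.aleph0_power_aleph0.le
  let P := {A : Set ℕ // LargeAlong U f A}
  have : Nonempty P := ⟨⟨Set.univ, fun k => by simpa using hf.large k⟩⟩
  obtain ⟨g, hgD, hg⟩ := exists_chain_of_dense (P := P) (ι := ℕ → ℕ → Fin 3)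
    (le := fun A B => AlmostSubset U f A.1 B.1)
    (D := fun F => {A | ∃ i j, ∃ S ∈ U, FiberHomogeneous f F i j S A.1})
    (fun A => AlmostSubset.refl U f A.1) (fun _ _ _ => AlmostSubset.trans)
    (fun p hp => by
      obtain ⟨B, hB, h⟩ := LargeAlong.exists_lowerBound hU.1 (fun n => (p n).2) hp
      exact ⟨⟨B, hB⟩, h⟩) hcard
    (fun F A => by
      obtain ⟨B, hBA, hB, h⟩ := A.2.exists_fiberHomogeneous hU hf F
      exact ⟨⟨B, hB⟩, h, Eventually.of_forall fun n => Set.inter_subset_left.trans hBA⟩)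
  let W : Filter ℕ :=
    { sets := {X | ∃ F, AlmostSubset U f (g F).1 X}
      univ_sets := ⟨fun _ _ => 0, Eventually.of_forall fun _ => Set.subset_univ _⟩
      sets_of_superset := fun ⟨F, hF⟩ h => ⟨F, hF.mono fun _ hn => hn.trans h⟩
      inter_sets := by
        rintro X Y ⟨F, hF⟩ ⟨G, hG⟩
        rcases hg F G with h | h
        · exact ⟨F, (hF.and (h.trans hG)).mono fun n hn => Set.subset_inter hn.1 hn.2⟩
        · exact ⟨G, ((h.trans hF).and hG).mono fun n hn => Set.subset_inter hn.1 hn.2⟩ }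
  have hWmem : ∀ X, X ∈ W ↔ ∃ F, AlmostSubset U f (g F).1 X := fun X => Iff.rfl
  have : W.NeBot := by
    rw [neBot_iff]
    intro hbot
    obtain ⟨F, hF⟩ := (hWmem ∅).mp (by rw [hbot]; exact mem_bot)
    obtain ⟨n, h1, h2⟩ := (hF.and ((g F).2 0)).exists
    obtain ⟨t, ht, x, hx, -⟩ := h2
    exact h1 (ht hx)
  have hle := Ultrafilter.of_le W
  refine ⟨Ultrafilter.of W, ?_, fun F => ⟨(g F).1, ?_, (g F).2, hgD F⟩⟩
  · rw [← Ultrafilter.coe_le_coe]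
    intro S hS
    refine hle ((hWmem _).mpr ⟨fun _ _ => 0, ?_⟩)
    filter_upwards [hS] with n hn x hx
    have : f x = n := hx.2
    change f x ∈ S
    rwa [this]
  · exact hle ((hWmem _).mpr ⟨F, AlmostSubset.refl U f _⟩)

/-! ### Properties of the generic ultrafilter -/

section Generic

variable {U V : Ultrafilter ℕ} {f : ℕ → ℕ}

theorem FiberHomogeneous.exists_fiber {F : ℕ → ℕ → Fin 3}
    {i j : Fin 3} {S A : Set ℕ} (hA : LargeAlong U f A) (hS : S ∈ U)
    (h : FiberHomogeneous f F i j S A) :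
    ∃ t : Finset ℕ, (t : Set ℕ) ⊆ A ∩ f ⁻¹' S ∧ (∃ x ∈ t, x + 2 < t.card) ∧
      Homogeneous F i t := by
  obtain ⟨n, ⟨t, ht, hx⟩, hn⟩ := ((hA 0).and hS).exists
  have hfn : ∀ x ∈ t, f x = n := fun x hx => (ht hx).2
  have hfS : ∀ x ∈ t, f x ∈ S := fun x hx => by rw [hfn x hx]; exact hn
  exact ⟨t, fun x hx => ⟨(ht hx).1, hfS x hx⟩, hx, fun x hx y hy hxy =>
    (h x (ht hx).1 y (ht hy).1 (hfS x hx) (hfS y hy) hxy).1 ((hfn x hx).trans (hfn y hy).symm)⟩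

/-- A function that is monotone on `A` agrees on `A` with a monotone function. -/
theorem exists_monotone_eqOn {g : ℕ → ℕ} {A : Set ℕ} (h : MonotoneOn g A) :
    ∃ g' : ℕ → ℕ, Monotone g' ∧ Set.EqOn g g' A := by
  classical
  refine ⟨fun n => ((Finset.range (n + 1)).filter (· ∈ A)).sup g, fun m n hmn => ?_, fun n hn => ?_⟩
  · exact Finset.sup_mono (Finset.filter_subset_filter _ (Finset.range_mono (by omega)))
  · apply le_antisymm
    · exact Finset.le_sup (f := g) (by simp [hn])
    · refine Finset.sup_le fun m hm => ?_
      simp only [Finset.mem_filter, Finset.mem_range] at hm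
      exact h hm.2 hn (by omega)

/-- There is no strictly decreasing regressive function on a set with more elements than one of
its members. -/
theorem not_strictAntiOn_of_card {g : ℕ → ℕ} (hg : ∀ n, g n ≤ n) {t : Finset ℕ}
    (ht : ∃ x ∈ t, x + 2 < t.card) : ¬ StrictAntiOn g t := by
  rintro hanti
  obtain ⟨x, hx, hcard⟩ := ht
  have hne : t.Nonempty := ⟨x, hx⟩
  have hmap : ∀ y ∈ t, g y ∈ Finset.range (x + 1) := fun y hy => by
    have h1 := hanti.antitoneOn (t.min'_mem hne) hy (t.min'_le y hy)
    have h2 := hg (t.min' hne)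
    have h3 := t.min'_le x hx
    rw [Finset.mem_range]
    omega
  have := Finset.card_le_card_of_injOn g hmap hanti.injOn
  rw [Finset.card_range] at this
  omega

theorem quasiSelective_of_generic (hU : Nonprincipal U) (hf : LargeFibers U f)
    (hVU : V.map f = U)
    (hV : ∀ F : ℕ → ℕ → Fin 3, ∃ A ∈ V, LargeAlong U f A ∧
      ∃ i j, ∃ S ∈ U, FiberHomogeneous f F i j S A) : QuasiSelective V := by
  refine ⟨fun n hn => hU (f n) (by rw [← hVU, hn, Ultrafilter.map_pure]), fun g hg => ?_⟩
  obtain ⟨A, hAV, hA, i, j, S, hS, h⟩ :=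
    hV fun x y => if g x < g y then 0 else if g x = g y then 1 else 2
  have hcol : ∀ x y, (if g x < g y then (0 : Fin 3) else if g x = g y then 1 else 2) = 2 ↔
      g y < g x := by
    intro x y
    split_ifs with h1 h2
    · simp; omega
    · simp; omega
    · simp; omega
  have hi : i ≠ 2 := by
    rintro rfl
    obtain ⟨t, -, ht, hhom⟩ := h.exists_fiber hA hS
    exact not_strictAntiOn_of_card hg ht fun x hx y hy hxy =>
      (hcol x y).mp (hhom x hx y hy hxy)
  have hj : j ≠ 2 := by
    rintro rfl
    -- A point with least `g`-value is contradicted by any point of `A` in a later fiber over `S`.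
    have hne : ∃ v x, x ∈ A ∧ f x ∈ S ∧ g x = v := by
      obtain ⟨t, ht, ⟨x, hx, -⟩, -⟩ := h.exists_fiber hA hS
      exact ⟨_, x, (ht hx).1, (ht hx).2, rfl⟩
    classical
    obtain ⟨x, hxA, hxS, hx⟩ := Nat.find_spec hne
    obtain ⟨n, ⟨⟨t, ht, y, hy, -⟩, hn⟩, hnx⟩ :=
      (((hA 0).and hS).and (hU.eventually_ge (f x + 1))).exists
    have hyn : f y = n := (ht hy).2
    have hxy : f x < f y := by omega
    have hlt := (hcol x y).mp
      ((h x hxA y (ht hy).1 hxS (hyn.symm ▸ hn) (hf.monotone.reflect_lt hxy)).2 hxy)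
    have := Nat.find_min' hne ⟨y, (ht hy).1, hyn.symm ▸ hn, rfl⟩
    omega
  have hmono : MonotoneOn g (A ∩ f ⁻¹' S) := by
    intro x hx y hy hxy
    rcases hxy.eq_or_lt with rfl | hxy
    · exact le_rfl
    have h1 := h x hx.1 y hy.1 hx.2 hy.2 hxy
    by_contra hlt
    have h2 := (hcol x y).mpr (not_le.mp hlt)
    rcases (hf.monotone hxy.le).eq_or_lt with he | hl
    · exact hi ((h1.1 he).symm.trans h2)
    · exact hj ((h1.2 hl).symm.trans h2)
  obtain ⟨g', hg', he⟩ := exists_monotone_eqOn hmono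
  refine ⟨g', hg', ?_⟩
  have hfS : f ⁻¹' S ∈ V := by rwa [← Ultrafilter.mem_map, hVU]
  filter_upwards [inter_mem hAV hfS] with x hx
  exact he hx

theorem not_injOn_of_generic (hVU : V.map f = U)
    (hV : ∀ F : ℕ → ℕ → Fin 3, ∃ A ∈ V, LargeAlong U f A ∧
      ∃ i j, ∃ S ∈ U, FiberHomogeneous f F i j S A) {X : Set ℕ} (hX : X ∈ V) :
    ¬ Set.InjOn f X := by
  classical
  intro hinj
  -- If `f` is injective on `X`, a fiber with a point `x` of `X` and two other points of `A` shows
  -- both colours.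
  obtain ⟨A, hAV, hA, i, j, S, hS, h⟩ := hV fun x y => if x ∈ X ∨ y ∈ X then 0 else 1
  have hfS : f ⁻¹' {n | n ∈ S ∧ Large 0 (A ∩ f ⁻¹' {n})} ∈ V := by
    rw [← Ultrafilter.mem_map, hVU]
    exact inter_mem hS (hA 0)
  obtain ⟨x, ⟨hxX, hxA⟩, hxS, t, htA, _, -, hcard⟩ :=
    V.nonempty_of_mem (inter_mem (inter_mem hX hAV) hfS)
  have hpair : ∀ a ∈ A, ∀ b ∈ A, f a = f x → f b = f x → a ≠ b →
      (if a ∈ X ∨ b ∈ X then (0 : Fin 3) else 1) = i := by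
    intro a ha b hb hfa hfb hab
    wlog hlt : a < b generalizing a b
    · simpa only [or_comm] using
        this b hb a ha hfb hfa hab.symm (lt_of_le_of_ne (not_lt.mp hlt) hab.symm)
    exact (h a ha b hb (hfa ▸ hxS) (hfb ▸ hxS) hlt).1 (hfa.trans hfb.symm)
  obtain ⟨y, hy, z, hz, hyz⟩ := Finset.one_lt_card.mp
    (show 1 < (t.erase x).card from lt_of_lt_of_le (by omega) Finset.pred_card_le_card_erase)
  rw [Finset.mem_erase] at hy hz
  have hout : ∀ y ∈ A ∩ f ⁻¹' {f x}, y ≠ x → y ∉ X := fun y hy hne hyX =>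
    hne (hinj hyX hxX hy.2)
  have h1 := hpair x hxA y (htA hy.2).1 rfl (htA hy.2).2 hy.1.symm
  have h2 := hpair y (htA hy.2).1 z (htA hz.2).1 (htA hy.2).2 (htA hz.2).2 hyz
  rw [if_pos (Or.inl hxX)] at h1
  rw [if_neg (by simp [hout y (htA hy.2) hy.1, hout z (htA hz.2) hz.1]), ← h1] at h2
  exact one_ne_zero h2

theorem squareBracketPairsThree_of_generic (hf : LargeFibers U f) (hVU : V.map f = U)
    (hV : ∀ F : ℕ → ℕ → Fin 3, ∃ A ∈ V, LargeAlong U f A ∧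
      ∃ i j, ∃ S ∈ U, FiberHomogeneous f F i j S A) : SquareBracketPairsThree V := by
  classical
  intro F
  obtain ⟨A, hAV, hA, i, j, S, hS, h⟩ :=
    hV fun x y => if hxy : x ≠ y then F ⟨{x, y}, by
      simp [Set.powersetCard.mem_iff, Finset.card_pair hxy]⟩ else 0
  have hfS : f ⁻¹' S ∈ V := by rwa [← Ultrafilter.mem_map, hVU]
  refine ⟨_, inter_mem hAV hfS, ?_⟩
  refine (Set.ncard_le_ncard (t := {i, j}) ?_ (Set.toFinite _)).trans ((Set.ncard_insert_le i {j}).trans (by simp))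
  rintro k ⟨⟨s, hs⟩, hsA, rfl⟩
  obtain ⟨x, y, hlt, rfl⟩ : ∃ x y, x < y ∧ s = {x, y} := by
    obtain ⟨x, y, hxy, rfl⟩ := Finset.card_eq_two.mp (Set.powersetCard.mem_iff.mp hs)
    rcases lt_or_gt_of_ne hxy with hlt | hlt
    · exact ⟨x, y, hlt, rfl⟩
    · exact ⟨y, x, hlt, Finset.pair_comm x y⟩
  have hx := hsA (show x ∈ (({x, y} : Finset ℕ) : Set ℕ) by simp)
  have hy := hsA (show y ∈ (({x, y} : Finset ℕ) : Set ℕ) by simp)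
  have h1 := h x hx.1 y hy.1 hx.2 hy.2 hlt
  dsimp only at h1
  rw [dif_pos hlt.ne] at h1
  rcases (hf.monotone hlt.le).eq_or_lt with he | hl
  · exact Or.inl (h1.1 he)
  · exact Or.inr (h1.2 hl)

end Generic

end NatUltrafilter

theorem mainTheorem2 (hCH : CH) (U : Ultrafilter ℕ) (hU : NatUltrafilter.Selective U) :
    ∃ V : Ultrafilter ℕ,
      NatUltrafilter.RudinKeislerAbove V U ∧
      NatUltrafilter.QuasiSelective V ∧
      ¬ NatUltrafilter.Selective V ∧
      ¬ NatUltrafilter.QPoint V ∧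
      NatUltrafilter.SquareBracketPairsThree V := by
  obtain ⟨f, hf⟩ := hU.exists_largeFibers
  obtain ⟨V, hVU, hV⟩ := NatUltrafilter.exists_generic_ultrafilter hCH hU hf
  refine ⟨V, ⟨f, hVU⟩, NatUltrafilter.quasiSelective_of_generic hU.1 hf hVU hV, fun hsel => ?_,
    fun hq => ?_, NatUltrafilter.squareBracketPairsThree_of_generic hf hVU hV⟩
  · rcases hsel.2 f with ⟨X, hX, c, hc⟩ | ⟨X, hX, hinj⟩
    · refine hU.1 c (Ultrafilter.coe_le_coe.mp ?_)
      rw [Ultrafilter.coe_pure, le_pure_iff, ← hVU, Ultrafilter.mem_coe, Ultrafilter.mem_map]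
      exact mem_of_superset hX hc
    · exact NatUltrafilter.not_injOn_of_generic hVU hV hX hinj
  · obtain ⟨X, hX, hinj⟩ := hq f hf.finite_fiber
    exact NatUltrafilter.not_injOn_of_generic hVU hV hX hinj
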